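/- Let $k,n\ge 1$ and let $P(\lambda)=\sum_{j=0}^{k}P_j\lambda^j$ be a matrix polynomial with $P_j\in\mathbb{C}^{n\times n}$, $P_k\neq 0$, which is regular, i.e. $\det P(\lambda)$ is not identically zero. Let $\phi_0,\dots,\phi_{k-1}\in\mathbb{C}[\lambda]$ be linearly independent polynomials of degree at most $k-1$ (for example the monomials, or the Dickson basis $\phi_0=2$, $\phi_1=\lambda$, $\phi_{j+1}=\lambda\phi_j-\phi_{j-1}$), put $\Phi=(\phi_0,\dots,\phi_{k-1})^T$, and let $c_{k-1}$ be the leading coefficient of $\phi_{k-1}$. Consider the spaces of pencils $L(\lambda)=\lambda X+Y$ with $X,Y\in\mathbb{C}^{kn\times kn}$ $$\mathcal{L}_1=\{L=\lambda X+Y:\ \exists\, v\in\mathbb{C}^k,\ L\cdot(\Phi\otimes I_n)=c_{k-1}\,v\otimes P\},$$ $$\mathcal{L}_2=\{L=\lambda X+Y:\ \exists\, w\in\mathbb{C}^k,\ (\Phi^T\otimes I_n)\cdot L=c_{k-1}\,w^T\otimes P\}.$$ A pencil $L=\lambda X+Y$ is called a linearization of $P$ if there are unimodular polynomial matrices $E(\lambda),F(\lambda)$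 with $E(\lambda)L(\lambda)F(\lambda)=\operatorname{diag}(P(\lambda),I_{(k-1)n})$, and a strong linearization of $P$ if, moreover, $\lambda Y+X$ is a linearization, in the same sense and with the same $k$, of $\operatorname{rev}P(\lambda)=\sum_{j=0}^{k}P_j\lambda^{k-j}$. Let $L\in\mathcal{L}_1$ or $L\in\mathcal{L}_2$. Then the following are equivalent: 1. $L$ is a linearization of $P$; 2. $L$ is a strong linearization of $P$; 3. $L$ is regular, i.e. $\det L(\lambda)$ is not identically zero. -/

import Mathlib

open Polynomial
open scoped Kronecker

namespace AnsatzPencil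

/-- The matrix polynomial `P(λ) = ∑_{j=0}^k P_j λ^j` with coefficients `P_0, …, P_k`. -/
noncomputable def matPoly {k n : ℕ} (P : Fin (k + 1) → Matrix (Fin n) (Fin n) ℂ) :
    Matrix (Fin n) (Fin n) ℂ[X] :=
  ∑ j : Fin (k + 1), (X ^ (j : ℕ) : ℂ[X]) • (P j).map C

/-- The reversal `rev P(λ) = ∑_{j=0}^k P_j λ^(k-j)`, given by its coefficients `P_k, …, P_0`. -/
def rev {k n : ℕ} (P : Fin (k + 1) → Matrix (Fin n) (Fin n) ℂ) :
    Fin (k + 1) → Matrix (Fin n) (Fin n) ℂ :=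
  fun j => P j.rev

/-- A square polynomial matrix is regular if its determinant does not vanish identically. -/
def IsRegular {ι : Type*} [Fintype ι] [DecidableEq ι] (M : Matrix ι ι ℂ[X]) : Prop :=
  M.det ≠ 0

/-- A square polynomial matrix is unimodular if its determinant is a unit of `ℂ[λ]`, that is,
a nonzero constant. -/
def IsUnimodular {ι : Type*} [Fintype ι] [DecidableEq ι] (M : Matrix ι ι ℂ[X]) : Prop :=
  IsUnit M.det

/-- A `kn × kn` pencil `λ A + B`, with rows and columns indexed by pairs
(block index, index inside the block). -/
@[ext]
structure Pencil (k n : ℕ) where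
  A : Matrix (Fin k × Fin n) (Fin k × Fin n) ℂ
  B : Matrix (Fin k × Fin n) (Fin k × Fin n) ℂ

/-- The polynomial matrix `λ A + B`. -/
noncomputable def Pencil.toMatrix {k n : ℕ} (L : Pencil k n) :
    Matrix (Fin k × Fin n) (Fin k × Fin n) ℂ[X] :=
  (X : ℂ[X]) • L.A.map C + L.B.map C

/-- The reversal `λ B + A` of the pencil `λ A + B`. -/
def Pencil.rev {k n : ℕ} (L : Pencil k n) : Pencil k n := ⟨L.B, L.A⟩

/-- The `kn × kn` block diagonal matrix `diag(M, I_{(k-1)n})`, with diagonal blocks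
`M, I_n, …, I_n`. -/
noncomputable def padded (k : ℕ) {n : ℕ} (M : Matrix (Fin n) (Fin n) ℂ[X]) :
    Matrix (Fin k × Fin n) (Fin k × Fin n) ℂ[X] :=
  Matrix.of fun p q =>
    if p.1 = q.1 then
      (if (p.1 : ℕ) = 0 then M else (1 : Matrix (Fin n) (Fin n) ℂ[X])) p.2 q.2
    else 0

/-- `L` is a linearization of `P`: `E L F = diag(P, I_{(k-1)n})` for some unimodular `E, F`. -/
def IsLinearization {k n : ℕ} (L : Pencil k n)
    (P : Fin (k + 1) → Matrix (Fin n) (Fin n) ℂ) : Prop :=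
  ∃ E F : Matrix (Fin k × Fin n) (Fin k × Fin n) ℂ[X],
    IsUnimodular E ∧ IsUnimodular F ∧ E * L.toMatrix * F = padded k (matPoly P)

/-- `L` is a strong linearization of `P`: `L` is a linearization of `P` and `rev L` is a
linearization of `rev P`. -/
def IsStrongLinearization {k n : ℕ} (L : Pencil k n)
    (P : Fin (k + 1) → Matrix (Fin n) (Fin n) ℂ) : Prop :=
  IsLinearization L P ∧ IsLinearization L.rev (rev P)

/-- The leading coefficient `c_{k-1}` of `φ_{k-1}`. -/
noncomputable def lastLeadingCoeff {k : ℕ} (hk : 0 < k) (φ : Fin k → ℂ[X]) : ℂ :=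
  (φ ⟨k - 1, Nat.sub_lt hk Nat.one_pos⟩).leadingCoeff

/-- The right ansatz space: pencils `L` such that `L (Φ ⊗ I_n) = c_{k-1} v ⊗ P` for some
`v ∈ ℂ^k`, where `Φ = (φ_0, …, φ_{k-1})ᵀ`. -/
def ansatz₁ {k n : ℕ} (hk : 0 < k) (φ : Fin k → ℂ[X])
    (P : Fin (k + 1) → Matrix (Fin n) (Fin n) ℂ) : Set (Pencil k n) :=
  {L | ∃ v : Fin k → ℂ,
    L.toMatrix * (Matrix.replicateCol Unit φ ⊗ₖ (1 : Matrix (Fin n) (Fin n) ℂ[X])) =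
      C (lastLeadingCoeff hk φ) • (Matrix.replicateCol Unit (fun i => C (v i)) ⊗ₖ matPoly P)}

/-- The left ansatz space: pencils `L` such that `(Φᵀ ⊗ I_n) L = c_{k-1} wᵀ ⊗ P` for some
`w ∈ ℂ^k`, where `Φ = (φ_0, …, φ_{k-1})ᵀ`. -/
def ansatz₂ {k n : ℕ} (hk : 0 < k) (φ : Fin k → ℂ[X])
    (P : Fin (k + 1) → Matrix (Fin n) (Fin n) ℂ) : Set (Pencil k n) :=
  {L | ∃ w : Fin k → ℂ,
    (Matrix.replicateRow Unit φ ⊗ₖ (1 : Matrix (Fin n) (Fin n) ℂ[X])) * L.toMatrix =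
      C (lastLeadingCoeff hk φ) • (Matrix.replicateRow Unit (fun i => C (w i)) ⊗ₖ matPoly P)}

end AnsatzPencil

/-! A linearization of a regular `P` is regular by comparing determinants; the content is that a
regular `L` in an ansatz space is a strong linearization. For the right space, regularity forces the
ansatz vector to be nonzero (`ansatz_vector_ne_zero`). Invertible constant matrices on the left and
right then move it to `e₀` and replace `φ` by the monomials, giving a pencil `Q` with `Q (Λ ⊗ I) =
e₀ ⊗ P`. Multiplying `Q` by a unimodular block Toeplitz matrix with first block column `Λ ⊗ I`
produces `[P, B; 0, D]`. Because `Q` has degree at most one, `D` is constant, and regularity makes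
it invertible, so `B` can be cleared (`exists_equiv_padded_of_monomial_ansatz`). Reversal preserves
regularity and turns the ansatz identity into one for `rev P` with the reflected basis
(`ansatz_rev`), so the same argument gives strongness. The left space follows by transposition. -/

namespace AnsatzPencil

/-! ### Constant and unimodular transformations -/

lemma exists_isUnit_mulVec_eq_single {K : Type*} [Field K] {m : ℕ} {v : Fin (m + 1) → K}
    (hv : v ≠ 0) :
    ∃ M : Matrix (Fin (m + 1)) (Fin (m + 1)) K, IsUnit M.det ∧ M.mulVec v = Pi.single 0 1 := by
  obtain ⟨i, hi⟩ := Function.ne_iff.mp hv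
  -- `A` sends `e_i` to `v` and has determinant `v i ≠ 0`, so `A⁻¹` sends `v` to `e_i`; a row swap
  -- then moves `e_i` to `e₀`.
  set A : Matrix (Fin (m + 1)) (Fin (m + 1)) K := (1 : Matrix _ _ K).updateCol i v
  have hA : IsUnit A.det := by
    have : A.det = v i := by
      rw [← Matrix.cramer_apply, Matrix.cramer_one]; rfl
    rw [this]; exact isUnit_iff_ne_zero.mpr hi
  have hAv : A.mulVec (Pi.single i 1) = v := by
    ext j; simp [A]
  have hinv : A⁻¹.mulVec v = Pi.single i 1 := by
    rw [← hAv, Matrix.mulVec_mulVec, Matrix.nonsing_inv_mul _ hA, Matrix.one_mulVec]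
  refine ⟨(A⁻¹).submatrix (Equiv.swap i 0) id, ?_, ?_⟩
  · have h := Matrix.det_permute (Equiv.swap i 0) A⁻¹
    rw [h]
    refine IsUnit.mul ?_ ?_
    · rcases Int.units_eq_one_or (Equiv.Perm.sign (Equiv.swap i (0 : Fin (m + 1)))) with h | h <;>
        simp [h]
    · exact Matrix.isUnit_nonsing_inv_det A hA
  · ext j
    have : (Matrix.mulVec ((A⁻¹).submatrix (Equiv.swap i 0) id) v) j
        = (A⁻¹.mulVec v) (Equiv.swap i 0 j) := rfl
    rw [this, hinv]
    simp only [Pi.single_apply]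
    congr 1
    rw [Equiv.swap_apply_eq_iff, Equiv.swap_apply_left]

lemma isUnit_det_map_C {ι : Type*} [Fintype ι] [DecidableEq ι] {M : Matrix ι ι ℂ}
    (hM : IsUnit M.det) : IsUnit (M.map (C : ℂ → ℂ[X])).det := by
  have := RingHom.map_det (C : ℂ →+* ℂ[X]) M
  have h2 : (M.map (C : ℂ → ℂ[X])) = (C : ℂ →+* ℂ[X]).mapMatrix M := rfl
  rw [h2, ← this]
  exact hM.map _

lemma isUnit_det_kronecker_one {R ι κ : Type*} [CommRing R] [Fintype ι] [DecidableEq ι]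
    [Fintype κ] [DecidableEq κ] {M : Matrix ι ι R} (hM : IsUnit M.det) :
    IsUnit (M ⊗ₖ (1 : Matrix κ κ R)).det := by
  rw [Matrix.det_kronecker]
  simpa using hM.pow _

/-- The lower unitriangular Toeplitz matrix with entries `X ^ (i - j)` for `j ≤ i`. -/
noncomputable def powToeplitz (m : ℕ) : Matrix (Fin (m + 1)) (Fin (m + 1)) ℂ[X] :=
  Matrix.of fun i j => if j ≤ i then X ^ ((i : ℕ) - j) else 0

lemma det_powToeplitz (m : ℕ) : (powToeplitz m).det = 1 := by
  rw [Matrix.det_of_isLowerTriangular]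
  · simp [powToeplitz]
  · intro i j hij
    have : i < j := hij
    simp [powToeplitz, this]

lemma powToeplitz_zero (m : ℕ) (i : Fin (m + 1)) : powToeplitz m i 0 = X ^ (i : ℕ) := by
  simp [powToeplitz]

/-- Horner recursion between neighbouring columns; it is what keeps degrees under control in the
block elimination. -/
lemma powToeplitz_castSucc (m : ℕ) (i : Fin (m + 1)) (j : Fin m) :
    powToeplitz m i j.castSucc =
      (1 : Matrix (Fin (m + 1)) (Fin (m + 1)) ℂ[X]) i j.castSucc
        + X * powToeplitz m i j.succ := by
  simp only [powToeplitz, Matrix.of_apply, Matrix.one_apply, Fin.le_def, Fin.ext_iff,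
    Fin.val_castSucc, Fin.val_succ]
  rcases lt_trichotomy (i : ℕ) j with h | h | h
  · rw [if_neg (by omega), if_neg (by omega), if_neg (by omega)]; simp
  · rw [if_pos (by omega), if_pos (by omega), if_neg (by omega)]; simp [h]
  · rw [if_pos (by omega), if_neg (by omega), if_pos (by omega), zero_add, ← pow_succ']
    congr 1; omega

lemma natDegree_eq_zero_of_X_mul {f : ℂ[X]} (h : (X * f).natDegree ≤ 1) : f.natDegree = 0 := by
  by_cases hf : f = 0
  · simp [hf]
  · rw [natDegree_X_mul hf] at h; omega

/-! ### Reduction to `diag(R, I)` for the monomial basis -/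

/-- The equivalence splitting off the first block. -/
def firstBlockEquiv (m n : ℕ) : Fin (m + 1) × Fin n ≃ Fin n ⊕ (Fin m × Fin n) where
  toFun p := Fin.cases (motive := fun _ => Fin n ⊕ (Fin m × Fin n))
    (Sum.inl p.2) (fun i => Sum.inr (i, p.2)) p.1
  invFun := Sum.elim (fun q => (0, q)) (fun p => (p.1.succ, p.2))
  left_inv := by
    rintro ⟨i, q⟩
    refine Fin.cases ?_ (fun i => ?_) i <;> simp
  right_inv := by
    rintro (q | ⟨i, q⟩) <;> simp

lemma padded_eq_submatrix {m n : ℕ} (R : Matrix (Fin n) (Fin n) ℂ[X]) :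
    padded (m + 1) R =
      (Matrix.fromBlocks R 0 0 1).submatrix (firstBlockEquiv m n) (firstBlockEquiv m n) := by
  ext1 ⟨i, q⟩ ⟨j, r⟩
  refine Fin.cases ?_ (fun i => ?_) i <;> refine Fin.cases ?_ (fun j => ?_) j
  · simp [padded, firstBlockEquiv]
  · simp [padded, firstBlockEquiv, (Fin.succ_ne_zero j).symm]
  · simp [padded, firstBlockEquiv]
  · by_cases h : i = j <;> simp [padded, firstBlockEquiv, Matrix.one_apply, h]

lemma det_padded {m n : ℕ} (R : Matrix (Fin n) (Fin n) ℂ[X]) :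
    (padded (m + 1) R).det = R.det := by
  rw [padded_eq_submatrix, Matrix.det_submatrix_equiv_self, Matrix.det_fromBlocks_zero₂₁,
    Matrix.det_one, mul_one]

/-- Block elimination: a block upper triangular matrix with unimodular lower right corner. -/
lemma exists_isUnimodular_mul_eq_padded {m n : ℕ} {R : Matrix (Fin n) (Fin n) ℂ[X]}
    {G : Matrix (Fin (m + 1) × Fin n) (Fin (m + 1) × Fin n) ℂ[X]}
    {B : Matrix (Fin n) (Fin m × Fin n) ℂ[X]}
    {D : Matrix (Fin m × Fin n) (Fin m × Fin n) ℂ[X]} (hD : IsUnit D.det)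
    (hG : G = (Matrix.fromBlocks R B 0 D).submatrix (firstBlockEquiv m n)
      (firstBlockEquiv m n)) :
    ∃ E : Matrix (Fin (m + 1) × Fin n) (Fin (m + 1) × Fin n) ℂ[X],
      IsUnimodular E ∧ E * G = padded (m + 1) R := by
  refine ⟨(Matrix.fromBlocks 1 (-(B * D⁻¹)) 0 D⁻¹).submatrix (firstBlockEquiv m n)
      (firstBlockEquiv m n), ?_, ?_⟩
  · rw [IsUnimodular, Matrix.det_submatrix_equiv_self, Matrix.det_fromBlocks_zero₂₁,
      Matrix.det_one, one_mul]
    exact Matrix.isUnit_nonsing_inv_det D hD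
  · rw [hG, Matrix.submatrix_mul_equiv, padded_eq_submatrix, Matrix.fromBlocks_multiply]
    congr 2 <;> simp [Matrix.mul_assoc, Matrix.nonsing_inv_mul D hD]

/-- A regular matrix `Q` with entries of degree at most one that satisfies the monomial ansatz
identity with ansatz vector `e₀` is equivalent to `diag(R, I)`. -/
lemma exists_equiv_padded_of_monomial_ansatz {m n : ℕ} {R : Matrix (Fin n) (Fin n) ℂ[X]}
    {Q : Matrix (Fin (m + 1) × Fin n) (Fin (m + 1) × Fin n) ℂ[X]}
    (hdeg : ∀ p q, (Q p q).natDegree ≤ 1) (hdet : Q.det ≠ 0)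
    (hQ : Q * (Matrix.replicateCol Unit (fun j : Fin (m + 1) => (X ^ (j : ℕ) : ℂ[X])) ⊗ₖ
        (1 : Matrix (Fin n) (Fin n) ℂ[X])) =
      Matrix.replicateCol Unit (Pi.single 0 1) ⊗ₖ R) :
    ∃ E F : Matrix (Fin (m + 1) × Fin n) (Fin (m + 1) × Fin n) ℂ[X],
      IsUnimodular E ∧ IsUnimodular F ∧ E * Q * F = padded (m + 1) R := by
  set U : Matrix (Fin (m + 1) × Fin n) (Fin (m + 1) × Fin n) ℂ[X] :=
    powToeplitz m ⊗ₖ (1 : Matrix (Fin n) (Fin n) ℂ[X])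
  have hU : U.det = 1 := by simp [U, Matrix.det_kronecker, det_powToeplitz]
  set G := Q * U with hGdef
  have hG0 : ∀ i q r, G (i, q) (0, r) = if i = 0 then R q r else 0 := by
    intro i q r
    have h := congrFun (congrFun hQ (i, q)) ((), r)
    have h2 : G (i, q) (0, r) = (Q * (Matrix.replicateCol Unit
        (fun j : Fin (m + 1) => (X ^ (j : ℕ) : ℂ[X])) ⊗ₖ
        (1 : Matrix (Fin n) (Fin n) ℂ[X]))) (i, q) ((), r) := by
      simp [hGdef, Matrix.mul_apply, U, powToeplitz_zero]
    rw [h2, h]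
    by_cases hi : i = 0 <;> simp [hi]
  have hstep : ∀ p (j : Fin m) r,
      G p (j.castSucc, r) = Q p (j.castSucc, r) + X * G p (j.succ, r) := by
    intro p j r
    have hUc : ∀ s, U s (j.castSucc, r) =
        (1 : Matrix (Fin (m + 1) × Fin n) (Fin (m + 1) × Fin n) ℂ[X]) s (j.castSucc, r)
          + X * U s (j.succ, r) := by
      rintro ⟨i, q⟩
      simp only [U, Matrix.kroneckerMap_apply, powToeplitz_castSucc, ← Matrix.one_kronecker_one]
      ring
    have h1 : Q p (j.castSucc, r) = ∑ s, Q p s *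
        (1 : Matrix (Fin (m + 1) × Fin n) (Fin (m + 1) × Fin n) ℂ[X]) s (j.castSucc, r) := by
      rw [← Matrix.mul_apply, Matrix.mul_one]
    rw [h1, hGdef, Matrix.mul_apply, Matrix.mul_apply, Finset.mul_sum, ← Finset.sum_add_distrib]
    refine Finset.sum_congr rfl fun s _ => ?_
    rw [hUc]; ring
  -- Below the first block row, block column 0 of `G` vanishes. By `hstep`, `X` times the next
  -- column is a constant minus an entry of `Q`, hence of degree at most one, so the next column is
  -- constant too.
  have hconst : ∀ (i : Fin m) q (j : Fin (m + 1)) r,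
      (G (i.succ, q) (j, r)).natDegree = 0 := by
    intro i q j r
    induction j using Fin.induction with
    | zero => rw [hG0]; simp
    | succ j ih =>
      apply natDegree_eq_zero_of_X_mul
      have : X * G (i.succ, q) (j.succ, r) =
          G (i.succ, q) (j.castSucc, r) - Q (i.succ, q) (j.castSucc, r) := by
        rw [hstep]; ring
      rw [this]
      exact (natDegree_sub_le _ _).trans (max_le (by omega) (hdeg _ _))
  set B : Matrix (Fin n) (Fin m × Fin n) ℂ[X] := Matrix.of fun q p => G (0, q) (p.1.succ, p.2)
  -- Taking constant coefficients loses nothing, by `hconst`.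
  set D₀ : Matrix (Fin m × Fin n) (Fin m × Fin n) ℂ :=
    Matrix.of fun p q => (G (p.1.succ, p.2) (q.1.succ, q.2)).coeff 0
  have hG : G = (Matrix.fromBlocks R B 0 (D₀.map C)).submatrix (firstBlockEquiv m n)
      (firstBlockEquiv m n) := by
    ext1 ⟨i, q⟩ ⟨j, r⟩
    refine Fin.cases ?_ (fun i => ?_) i <;> refine Fin.cases ?_ (fun j => ?_) j
    · rw [hG0]; simp [firstBlockEquiv]
    · simp [firstBlockEquiv, B]
    · rw [hG0]; simp [firstBlockEquiv]
    · simpa [firstBlockEquiv, D₀] using eq_C_of_natDegree_eq_zero (hconst i q j.succ r)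
  have hGdet : G.det = R.det * (D₀.map (C : ℂ → ℂ[X])).det := by
    rw [hG, Matrix.det_submatrix_equiv_self, Matrix.det_fromBlocks_zero₂₁]
  have hD : D₀.det ≠ 0 := by
    intro h0
    have h1 : (D₀.map (C : ℂ → ℂ[X])).det = 0 := by
      have := RingHom.map_det (C : ℂ →+* ℂ[X]) D₀
      rw [h0, map_zero] at this
      exact this.symm
    rw [h1, mul_zero, hGdef, Matrix.det_mul, hU, mul_one] at hGdet
    exact hdet hGdet
  obtain ⟨E, hE, hEG⟩ :=
    exists_isUnimodular_mul_eq_padded (isUnit_det_map_C (isUnit_iff_ne_zero.mpr hD)) hG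
  exact ⟨E, U, hE, by rw [IsUnimodular, hU]; exact isUnit_one, by rw [Matrix.mul_assoc, hEG]⟩

/-! ### Change of basis and linearization from regularity -/

lemma natDegree_mul_apply_le {ι κ μ : Type*} [Fintype κ] {M : Matrix ι κ ℂ[X]}
    {N : Matrix κ μ ℂ[X]} {a b : ℕ} (hM : ∀ i j, (M i j).natDegree ≤ a)
    (hN : ∀ i j, (N i j).natDegree ≤ b) (i : ι) (j : μ) : ((M * N) i j).natDegree ≤ a + b := by
  rw [Matrix.mul_apply]
  exact natDegree_sum_le_of_forall_le _ _ fun s _ =>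
    natDegree_mul_le.trans (add_le_add (hM _ _) (hN _ _))

lemma natDegree_map_C_kronecker_one {ι κ : Type*} [DecidableEq κ] (M : Matrix ι ι ℂ)
    (p q : ι × κ) : ((M.map (C : ℂ → ℂ[X]) ⊗ₖ (1 : Matrix κ κ ℂ[X])) p q).natDegree ≤ 0 := by
  by_cases h : p.2 = q.2 <;> simp [Matrix.kroneckerMap_apply, Matrix.one_apply, h]

lemma Pencil.toMatrix_apply {k n : ℕ} (L : Pencil k n) (p q : Fin k × Fin n) :
    L.toMatrix p q = X * C (L.A p q) + C (L.B p q) := by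
  simp [Pencil.toMatrix]

lemma Pencil.natDegree_toMatrix_le {k n : ℕ} (L : Pencil k n) (p q : Fin k × Fin n) :
    (L.toMatrix p q).natDegree ≤ 1 := by
  rw [L.toMatrix_apply, mul_comm]
  exact natDegree_linear_le

/-- The matrix of coefficients of a family of polynomials in the monomial basis. -/
def coeffMatrix {k : ℕ} (φ : Fin k → ℂ[X]) : Matrix (Fin k) (Fin k) ℂ :=
  Matrix.of fun i j => (φ i).coeff j

lemma eq_sum_coeffMatrix {k : ℕ} {φ : Fin k → ℂ[X]} (hdeg : ∀ i, (φ i).natDegree < k)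
    (i : Fin k) : φ i = ∑ j : Fin k, C (coeffMatrix φ i j) * X ^ (j : ℕ) :=
  (as_sum_range_C_mul_X_pow' _ (hdeg i)).trans
    (Fin.sum_univ_eq_sum_range (fun j => C ((φ i).coeff j) * X ^ j) k).symm

lemma isUnit_det_coeffMatrix {k : ℕ} {φ : Fin k → ℂ[X]} (hφ : LinearIndependent ℂ φ)
    (hdeg : ∀ i, (φ i).natDegree < k) : IsUnit (coeffMatrix φ).det := by
  rw [← Matrix.isUnit_iff_isUnit_det, ← Matrix.linearIndependent_rows_iff_isUnit]
  have h : Fintype.linearCombination ℂ (fun j : Fin k => (X ^ (j : ℕ) : ℂ[X])) ∘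
      (coeffMatrix φ).row = φ := by
    ext1 i
    rw [eq_sum_coeffMatrix hdeg i]
    simp [Fintype.linearCombination_apply, smul_eq_C_mul]
  -- A dependence among the coefficient rows would map to one among the `φ i`.
  exact LinearIndependent.of_comp _ (h.symm ▸ hφ)

lemma replicateCol_eq_coeffMatrix_mul {k : ℕ} {φ : Fin k → ℂ[X]}
    (hdeg : ∀ i, (φ i).natDegree < k) :
    Matrix.replicateCol Unit φ = (coeffMatrix φ).map C *
      Matrix.replicateCol Unit (fun j : Fin k => (X ^ (j : ℕ) : ℂ[X])) := by
  ext1 i u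
  rw [Matrix.mul_apply]
  exact eq_sum_coeffMatrix hdeg i

/-- If `v = 0`, multiplying by the adjugate gives `det M • (Φ ⊗ I) = 0`, although `det M` and every
`φ i` are nonzero. -/
lemma ansatz_vector_ne_zero {k n : ℕ} (hk : 0 < k) (hn : 0 < n) {φ : Fin k → ℂ[X]}
    (hφ : LinearIndependent ℂ φ) {M : Matrix (Fin k × Fin n) (Fin k × Fin n) ℂ[X]}
    (hM : M.det ≠ 0) {R : Matrix (Fin n) (Fin n) ℂ[X]} {v : Fin k → ℂ}
    (h : M * (Matrix.replicateCol Unit φ ⊗ₖ (1 : Matrix (Fin n) (Fin n) ℂ[X])) =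
      Matrix.replicateCol Unit (fun i => C (v i)) ⊗ₖ R) : v ≠ 0 := by
  rintro rfl
  have h0 : M * (Matrix.replicateCol Unit φ ⊗ₖ (1 : Matrix (Fin n) (Fin n) ℂ[X])) = 0 := by
    rw [h]; ext1 p q; simp
  have h1 := congrArg (fun N => M.adjugate * N) h0
  simp only [← Matrix.mul_assoc, Matrix.adjugate_mul, Matrix.mul_zero, Matrix.smul_mul,
    Matrix.one_mul] at h1
  have h2 := congrFun (congrFun h1 (⟨0, hk⟩, ⟨0, hn⟩)) ((), ⟨0, hn⟩)
  simp only [Matrix.smul_apply, Matrix.kroneckerMap_apply, Matrix.one_apply_eq,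
    Matrix.replicateCol_apply, Matrix.zero_apply, smul_eq_mul, mul_one, mul_eq_zero] at h2
  exact h2.elim hM (hφ.ne_zero _)

/-- A regular pencil satisfying the right ansatz identity is a linearization. -/
lemma isLinearization_of_isRegular {m n : ℕ} (hn : 0 < n)
    {P : Fin (m + 1 + 1) → Matrix (Fin n) (Fin n) ℂ} {φ : Fin (m + 1) → ℂ[X]}
    (hφ : LinearIndependent ℂ φ) (hdeg : ∀ i, (φ i).natDegree < m + 1) {L : Pencil (m + 1) n}
    {v : Fin (m + 1) → ℂ}
    (hL : L.toMatrix * (Matrix.replicateCol Unit φ ⊗ₖ (1 : Matrix (Fin n) (Fin n) ℂ[X])) =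
      Matrix.replicateCol Unit (fun i => C (v i)) ⊗ₖ matPoly P)
    (hreg : IsRegular L.toMatrix) : IsLinearization L P := by
  obtain ⟨M, hM, hMv⟩ := exists_isUnit_mulVec_eq_single
    (ansatz_vector_ne_zero m.succ_pos hn hφ hreg hL)
  set M' := M.map (C : ℂ → ℂ[X]) ⊗ₖ (1 : Matrix (Fin n) (Fin n) ℂ[X]) with hM'
  set T' := (coeffMatrix φ).map (C : ℂ → ℂ[X]) ⊗ₖ (1 : Matrix (Fin n) (Fin n) ℂ[X]) with hT'
  have hMu : IsUnit M'.det := isUnit_det_kronecker_one (isUnit_det_map_C hM)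
  have hTu : IsUnit T'.det :=
    isUnit_det_kronecker_one (isUnit_det_map_C (isUnit_det_coeffMatrix hφ hdeg))
  have hQ : M' * L.toMatrix * T' *
      (Matrix.replicateCol Unit (fun j : Fin (m + 1) => (X ^ (j : ℕ) : ℂ[X])) ⊗ₖ
        (1 : Matrix (Fin n) (Fin n) ℂ[X])) =
      Matrix.replicateCol Unit (Pi.single 0 1) ⊗ₖ matPoly P := by
    have hT : T' * (Matrix.replicateCol Unit (fun j : Fin (m + 1) => (X ^ (j : ℕ) : ℂ[X])) ⊗ₖ
        (1 : Matrix (Fin n) (Fin n) ℂ[X])) =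
        Matrix.replicateCol Unit φ ⊗ₖ (1 : Matrix (Fin n) (Fin n) ℂ[X]) := by
      rw [hT', ← Matrix.mul_kronecker_mul, ← replicateCol_eq_coeffMatrix_mul hdeg, Matrix.one_mul]
    rw [Matrix.mul_assoc, hT, Matrix.mul_assoc, hL, hM', ← Matrix.mul_kronecker_mul,
      Matrix.one_mul]
    congr 1
    ext1 i u
    have h := congrArg (C : ℂ → ℂ[X]) (congrFun hMv i)
    rw [Matrix.mul_apply]
    simp only [Matrix.mulVec, dotProduct, map_sum, map_mul] at h
    refine Eq.trans h ?_
    by_cases hi : i = 0 <;> simp [hi]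
  have hQdeg : ∀ p q, ((M' * L.toMatrix * T') p q).natDegree ≤ 1 := fun p q =>
    natDegree_mul_apply_le (a := 1) (b := 0)
      (natDegree_mul_apply_le (a := 0) (b := 1) (natDegree_map_C_kronecker_one M)
        L.natDegree_toMatrix_le)
      (natDegree_map_C_kronecker_one _) p q
  have hQdet : (M' * L.toMatrix * T').det ≠ 0 := by
    rw [Matrix.det_mul, Matrix.det_mul]
    exact mul_ne_zero (mul_ne_zero hMu.ne_zero hreg) hTu.ne_zero
  obtain ⟨E, F, hE, hF, h⟩ := exists_equiv_padded_of_monomial_ansatz hQdeg hQdet hQ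
  refine ⟨E * M', T' * F, ?_, ?_, ?_⟩
  · rw [IsUnimodular, Matrix.det_mul]; exact hE.mul hMu
  · rw [IsUnimodular, Matrix.det_mul]; exact hTu.mul hF
  · rw [← h]; simp only [Matrix.mul_assoc]

lemma isRegular_of_isLinearization {m n : ℕ} {P : Fin (m + 1 + 1) → Matrix (Fin n) (Fin n) ℂ}
    (hP : IsRegular (matPoly P)) {L : Pencil (m + 1) n} (h : IsLinearization L P) :
    IsRegular L.toMatrix := by
  obtain ⟨E, F, -, -, h⟩ := h
  intro h0
  have h1 := congrArg Matrix.det h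
  rw [Matrix.det_mul, Matrix.det_mul, h0, mul_zero, zero_mul, det_padded] at h1
  exact hP h1.symm

/-! ### Reversal and strong linearizations -/

/-- `Polynomial.reflect N` as a linear map. -/
noncomputable def reflectLinearMap (N : ℕ) : ℂ[X] →ₗ[ℂ] ℂ[X] where
  toFun := reflect N
  map_add' f g := reflect_add f g N
  map_smul' a f := by simp only [smul_eq_C_mul, reflect_C_mul, RingHom.id_apply]

lemma linearIndependent_reflect {k N : ℕ} {φ : Fin k → ℂ[X]} (hφ : LinearIndependent ℂ φ) :
    LinearIndependent ℂ (fun i => reflect N (φ i)) :=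
  hφ.map' (reflectLinearMap N) (LinearMap.ker_eq_bot'.mpr fun _ h => reflect_eq_zero_iff.mp h)

lemma Pencil.toMatrix_rev_apply {k n : ℕ} (L : Pencil k n) (p q : Fin k × Fin n) :
    L.rev.toMatrix p q = reflect 1 (L.toMatrix p q) := by
  rw [toMatrix_apply, toMatrix_apply, reflect_add, mul_comm X (C _), mul_comm X (C _),
    reflect_C_mul, reflect_one_X, reflect_C]
  simp only [Pencil.rev]
  ring

lemma matPoly_apply {k n : ℕ} (P : Fin (k + 1) → Matrix (Fin n) (Fin n) ℂ) (q r : Fin n) :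
    matPoly P q r = ∑ j : Fin (k + 1), C (P j q r) * X ^ (j : ℕ) := by
  rw [matPoly, Matrix.sum_apply]
  refine Finset.sum_congr rfl fun j _ => ?_
  rw [Matrix.smul_apply, Matrix.map_apply, smul_eq_mul, mul_comm]

lemma matPoly_rev_apply {k n : ℕ} (P : Fin (k + 1) → Matrix (Fin n) (Fin n) ℂ) (q r : Fin n) :
    matPoly (rev P) q r = reflect k (matPoly P q r) := by
  have h : reflect k (matPoly P q r) = ∑ j : Fin (k + 1), C (P j q r) * X ^ (k - (j : ℕ)) := by
    rw [matPoly_apply]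
    refine Eq.trans (map_sum (reflectLinearMap k) (fun j : Fin (k + 1) => C (P j q r) *
      X ^ (j : ℕ)) Finset.univ) (Finset.sum_congr rfl fun j _ => ?_)
    change reflect k (C (P j q r) * X ^ (j : ℕ)) = _
    rw [reflect_C_mul_X_pow, revAt_le (by omega)]
  rw [h, matPoly_apply, ← Equiv.sum_comp Fin.revPerm]
  refine Finset.sum_congr rfl fun j _ => ?_
  simp only [rev, Fin.revPerm_apply, Fin.rev_rev, Fin.val_rev]
  congr 2
  omega

/-- The right ansatz identity is inherited by the reversals. -/
lemma ansatz_rev {m n : ℕ} {P : Fin (m + 1 + 1) → Matrix (Fin n) (Fin n) ℂ}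
    {φ : Fin (m + 1) → ℂ[X]} (hdeg : ∀ i, (φ i).natDegree < m + 1) {L : Pencil (m + 1) n}
    {v : Fin (m + 1) → ℂ}
    (hL : L.toMatrix * (Matrix.replicateCol Unit φ ⊗ₖ (1 : Matrix (Fin n) (Fin n) ℂ[X])) =
      Matrix.replicateCol Unit (fun i => C (v i)) ⊗ₖ matPoly P) :
    L.rev.toMatrix * (Matrix.replicateCol Unit (fun i => reflect m (φ i)) ⊗ₖ
        (1 : Matrix (Fin n) (Fin n) ℂ[X])) =
      Matrix.replicateCol Unit (fun i => C (v i)) ⊗ₖ matPoly (rev P) := by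
  ext1 p r
  have h := congrArg (reflectLinearMap (m + 1)) (congrFun (congrFun hL p) r)
  rw [Matrix.mul_apply, map_sum] at h
  rw [Matrix.mul_apply]
  refine Eq.trans (Finset.sum_congr rfl fun s _ => ?_) (h.trans ?_)
  · change L.rev.toMatrix p s * (reflect m (φ s.1) * (1 : Matrix (Fin n) (Fin n) ℂ[X]) s.2 r.2) =
      reflect (m + 1) (L.toMatrix p s * (φ s.1 * (1 : Matrix (Fin n) (Fin n) ℂ[X]) s.2 r.2))
    by_cases h : s.2 = r.2
    -- Reflection at `m + 1` factors as reflection at 1 on the pencil entry times reflection at `m`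
    -- on `φ`, by the two degree bounds.
    · have h1 := reflect_mul _ _ (L.natDegree_toMatrix_le p s) (Nat.lt_succ_iff.mp (hdeg s.1))
      rw [add_comm 1 m] at h1
      rw [h, Matrix.one_apply_eq, mul_one, mul_one, h1, L.toMatrix_rev_apply]
    · rw [Matrix.one_apply_ne h]; simp
  · change reflect (m + 1) (C (v p.1) * matPoly P p.2 r.2) =
      C (v p.1) * matPoly (rev P) p.2 r.2
    rw [reflect_C_mul, matPoly_rev_apply]

/-- For `z ≠ 0` one has `L(z) = z • (rev L)(z⁻¹)`, so a vanishing `det (rev L)` would make `det L`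
vanish at every such `z`. -/
lemma isRegular_rev {k n : ℕ} {L : Pencil k n} (h : IsRegular L.toMatrix) :
    IsRegular L.rev.toMatrix := by
  -- The extra factor `X` makes the chosen point nonzero.
  obtain ⟨z, hz⟩ : ∃ z : ℂ, (X * L.toMatrix.det).eval z ≠ 0 := by
    by_contra! h0
    exact mul_ne_zero X_ne_zero h (Polynomial.funext fun z => by simpa using h0 z)
  rw [eval_mul, eval_X] at hz
  have hz0 : z ≠ 0 := left_ne_zero_of_mul hz
  intro hrev
  refine right_ne_zero_of_mul hz ?_
  have h1 : (evalRingHom z).mapMatrix L.toMatrix =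
      z • (evalRingHom z⁻¹).mapMatrix L.rev.toMatrix := by
    ext1 p q
    simp only [RingHom.mapMatrix_apply, Matrix.map_apply, Matrix.smul_apply,
      Pencil.toMatrix_apply, coe_evalRingHom, eval_add, eval_mul, eval_X, eval_C, smul_eq_mul,
      Pencil.rev]
    field_simp
    ring
  change evalRingHom z _ = 0
  rw [RingHom.map_det, h1, Matrix.det_smul, ← RingHom.map_det, hrev, map_zero, mul_zero]

/-- Strong linearizations from the right ansatz identity. -/
lemma isStrongLinearization_of_isRegular {m n : ℕ} (hn : 0 < n)
    {P : Fin (m + 1 + 1) → Matrix (Fin n) (Fin n) ℂ} {φ : Fin (m + 1) → ℂ[X]}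
    (hφ : LinearIndependent ℂ φ) (hdeg : ∀ i, (φ i).natDegree < m + 1) {L : Pencil (m + 1) n}
    {v : Fin (m + 1) → ℂ}
    (hL : L.toMatrix * (Matrix.replicateCol Unit φ ⊗ₖ (1 : Matrix (Fin n) (Fin n) ℂ[X])) =
      Matrix.replicateCol Unit (fun i => C (v i)) ⊗ₖ matPoly P)
    (hreg : IsRegular L.toMatrix) : IsStrongLinearization L P :=
  ⟨isLinearization_of_isRegular hn hφ hdeg hL hreg,
    isLinearization_of_isRegular hn (linearIndependent_reflect hφ)
      (fun i => natDegree_reflect_le.trans_lt (max_lt m.lt_succ_self (hdeg i)))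
      (ansatz_rev hdeg hL) (isRegular_rev hreg)⟩

/-! ### Transposition and the left ansatz space -/

/-- The transpose of a pencil. -/
def Pencil.transpose {k n : ℕ} (L : Pencil k n) : Pencil k n := ⟨L.A.transpose, L.B.transpose⟩

lemma Pencil.toMatrix_transpose {k n : ℕ} (L : Pencil k n) :
    L.transpose.toMatrix = L.toMatrix.transpose := by
  ext1 p q
  rw [Matrix.transpose_apply, toMatrix_apply, toMatrix_apply]
  rfl

lemma matPoly_transpose {k n : ℕ} (P : Fin (k + 1) → Matrix (Fin n) (Fin n) ℂ) :
    matPoly (fun j => (P j).transpose) = (matPoly P).transpose := by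
  ext1 q r
  rw [Matrix.transpose_apply, matPoly_apply, matPoly_apply]
  rfl

lemma padded_transpose {m n : ℕ} (R : Matrix (Fin n) (Fin n) ℂ[X]) :
    padded (m + 1) R.transpose = (padded (m + 1) R).transpose := by
  rw [padded_eq_submatrix, padded_eq_submatrix, Matrix.transpose_submatrix,
    Matrix.fromBlocks_transpose]
  simp

lemma isLinearization_of_transpose {m n : ℕ} {P : Fin (m + 1 + 1) → Matrix (Fin n) (Fin n) ℂ}
    {L : Pencil (m + 1) n} (h : IsLinearization L.transpose (fun j => (P j).transpose)) :
    IsLinearization L P := by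
  obtain ⟨E, F, hE, hF, h⟩ := h
  refine ⟨F.transpose, E.transpose, ?_, ?_, ?_⟩
  · rwa [IsUnimodular, Matrix.det_transpose]
  · rwa [IsUnimodular, Matrix.det_transpose]
  · have h1 := congrArg Matrix.transpose h
    rw [matPoly_transpose, padded_transpose, Matrix.transpose_transpose,
      Matrix.transpose_mul, Matrix.transpose_mul, L.toMatrix_transpose,
      Matrix.transpose_transpose, ← Matrix.mul_assoc] at h1
    exact h1

lemma isStrongLinearization_of_transpose {m n : ℕ}
    {P : Fin (m + 1 + 1) → Matrix (Fin n) (Fin n) ℂ} {L : Pencil (m + 1) n}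
    (h : IsStrongLinearization L.transpose (fun j => (P j).transpose)) :
    IsStrongLinearization L P :=
  -- Reversal commutes with transposition definitionally, so `h.2` already has the required form.
  ⟨isLinearization_of_transpose h.1, isLinearization_of_transpose h.2⟩

lemma C_smul_replicateCol_kronecker {k n : ℕ} (c : ℂ) (v : Fin k → ℂ)
    (R : Matrix (Fin n) (Fin n) ℂ[X]) :
    (C c : ℂ[X]) • (Matrix.replicateCol Unit (fun i => (C (v i) : ℂ[X])) ⊗ₖ R) =
      Matrix.replicateCol Unit (fun i => C ((c • v) i)) ⊗ₖ R := by
  ext1 p q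
  simp [Matrix.kroneckerMap_apply, mul_assoc]

lemma transpose_mem_ansatz₁ {k n : ℕ} {hk : 0 < k} {φ : Fin k → ℂ[X]}
    {P : Fin (k + 1) → Matrix (Fin n) (Fin n) ℂ} {L : Pencil k n} (hL : L ∈ ansatz₂ hk φ P) :
    L.transpose ∈ ansatz₁ hk φ (fun j => (P j).transpose) := by
  obtain ⟨w, hw⟩ := hL
  refine ⟨w, ?_⟩
  have h := congrArg Matrix.transpose hw
  rw [Matrix.transpose_mul, Matrix.transpose_smul, ← Matrix.kroneckerMap_transpose,
    ← Matrix.kroneckerMap_transpose, Matrix.transpose_one, ← matPoly_transpose,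
    ← L.toMatrix_transpose, Matrix.transpose_replicateRow, Matrix.transpose_replicateRow] at h
  exact h

lemma isStrongLinearization_of_mem_ansatz₁ {m n : ℕ} (hn : 0 < n) {hk : 0 < m + 1}
    {P : Fin (m + 1 + 1) → Matrix (Fin n) (Fin n) ℂ} {φ : Fin (m + 1) → ℂ[X]}
    (hφ : LinearIndependent ℂ φ) (hdeg : ∀ i, (φ i).natDegree < m + 1) {L : Pencil (m + 1) n}
    (hL : L ∈ ansatz₁ hk φ P) (hreg : IsRegular L.toMatrix) : IsStrongLinearization L P := by
  obtain ⟨v, hv⟩ := hL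
  -- The scalar `c_{k-1}` is absorbed into the ansatz vector.
  rw [C_smul_replicateCol_kronecker] at hv
  exact isStrongLinearization_of_isRegular hn hφ hdeg hv hreg

end AnsatzPencil

theorem mainTheorem5 (k n : ℕ) (hk : 0 < k)
    (P : Fin (k + 1) → Matrix (Fin n) (Fin n) ℂ)
    (hPk : P (Fin.last k) ≠ 0)
    (hP : AnsatzPencil.IsRegular (AnsatzPencil.matPoly P))
    (φ : Fin k → Polynomial ℂ)
    (hφ : LinearIndependent ℂ φ)
    (hdeg : ∀ i, (φ i).natDegree ≤ k - 1)
    (L : AnsatzPencil.Pencil k n)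
    (hL : L ∈ AnsatzPencil.ansatz₁ hk φ P ∨ L ∈ AnsatzPencil.ansatz₂ hk φ P) :
    List.TFAE [AnsatzPencil.IsLinearization L P,
      AnsatzPencil.IsStrongLinearization L P,
      AnsatzPencil.IsRegular L.toMatrix] := by
  have hn : 0 < n := by
    rcases Nat.eq_zero_or_pos n with rfl | h
    -- All 0 × 0 matrices are equal, so `P_k ≠ 0` excludes `n = 0`.
    · exact absurd (Subsingleton.elim _ _) hPk
    · exact h
  obtain ⟨m, rfl⟩ : ∃ m, k = m + 1 := ⟨k - 1, by omega⟩
  have hdeg' : ∀ i, (φ i).natDegree < m + 1 := fun i => Nat.lt_succ_of_le (hdeg i)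
  tfae_have 2 → 1 := fun h => h.1
  tfae_have 1 → 3 := AnsatzPencil.isRegular_of_isLinearization hP
  tfae_have 3 → 2 := fun hreg => by
    rcases hL with hL | hL
    · exact AnsatzPencil.isStrongLinearization_of_mem_ansatz₁ hn hφ hdeg' hL hreg
    · refine AnsatzPencil.isStrongLinearization_of_transpose
        (AnsatzPencil.isStrongLinearization_of_mem_ansatz₁ hn hφ hdeg'
          (AnsatzPencil.transpose_mem_ansatz₁ hL) ?_)
      rwa [AnsatzPencil.IsRegular, AnsatzPencil.Pencil.toMatrix_transpose, Matrix.det_transpose]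
  tfae_finish
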